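/- Let $d_1,\dots,d_n\ge 1$ be integers and $\mathcal H=\mathbb C^{d_1}\otimes\cdots\otimes\mathbb C^{d_n}$. An $n$-partite pure state is a unit vector $|\psi\rangle\in\mathcal H$; it is product across the cut $S:S^c$, where $\emptyset\ne S\subsetneq\{1,\dots,n\}$, if $|\psi\rangle=|\alpha\rangle_S\otimes|\beta\rangle_{S^c}$ for some unit vectors $|\alpha\rangle$, $|\beta\rangle$ in the tensor products of the factors indexed by $S$ and by $S^c$. Let $\mathcal P\subset\mathcal H$ be the set of pure states that are product across some such cut. For pure states let $\|\psi-\phi\|_{\mathrm{tr}}=\tfrac12\operatorname{tr}\bigl|\,|\psi\rangle\langle\psi|-|\phi\rangle\langle\phi|\,\bigr|$ be the trace distance. A quantum $\varepsilon$-tester for $\mathcal P$ using $k$ copies is a two-outcome measurement $\{\Lambda,I-\Lambda\}$, $0\le\Lambda\le I$, on $\mathcal H^{\otimes k}$ such that, for every pure state $|\psi\rangle\in\mathcal H$: if $|\psi\rangle\in\mathcal P$, then $|\psi\rangle^{\otimes k}$ is accepted (outcome $\Lambda$) with probability at least $2/3$; and if $\inf_{|\phi\rangle\in\mathcal P}\|\psi-\phi\|_{\mathrm{tr}}\ge\varepsilon$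 (with $\inf\emptyset=+\infty$), then $|\psi\rangle^{\otimes k}$ is rejected with probability at least $2/3$. Theorem. There is a universal constant $C>0$ such that for every $n$ and every $\varepsilon>0$ there is an integer $0\le k\le C\,n/\varepsilon^2$ with the following property: for all local dimensions $d_1,\dots,d_n$ there is a quantum $\varepsilon$-tester, using $k$ copies of the state, for the property $\mathcal P$ of being product across some cut. -/

import Mathlib

open scoped BigOperators

noncomputable section

namespace QTest

variable {ι : Type} [Fintype ι] [DecidableEq ι]

/-- The rank-one operator `|ψ⟩⟨ψ|`. -/
def proj (ψ : EuclideanSpace ℂ ι) : Matrix ι ι ℂ :=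
  Matrix.vecMulVec (fun x => ψ x) (fun x => star (ψ x))

open scoped MatrixOrder in
/-- The trace norm `tr |A|`, where `|A| = √(A* A)`. -/
def trAbs (A : Matrix ι ι ℂ) : ℝ := (CFC.abs A).trace.re

/-- The trace distance `(1/2) tr | |ψ⟩⟨ψ| - |φ⟩⟨φ| |` of two pure states. -/
def traceDist (ψ φ : EuclideanSpace ℂ ι) : ℝ := (1 / 2) * trAbs (proj ψ - proj φ)

/-- The state `ψ^{⊗k}`, as a vector of `(ℂ^ι)^{⊗k} = ℂ^(ι^k)`. -/
def tensorPow (k : ℕ) (ψ : EuclideanSpace ℂ ι) : EuclideanSpace ℂ (Fin k → ι) :=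
  WithLp.toLp 2 fun x => ∏ j, ψ (x j)

open scoped ComplexOrder in
/-- `Λ` is the accepting element of a two-outcome measurement `{Λ, I - Λ}`: `0 ≤ Λ ≤ I`. -/
def IsMeasurement (Λ : Matrix ι ι ℂ) : Prop := Λ.PosSemidef ∧ (1 - Λ).PosSemidef

/-- The probability `tr (Λ |ψ⟩⟨ψ|)` that the measurement `{Λ, I - Λ}` accepts `ψ`. -/
def acceptProb (Λ : Matrix ι ι ℂ) (ψ : EuclideanSpace ℂ ι) : ℝ := (Λ * proj ψ).trace.re

/-- `Λ` is a quantum `ε`-tester for the set `P` of pure states, using `k` copies of the input: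
a two-outcome measurement on `k` copies that accepts every state in `P` with probability at
least `2/3` and rejects with probability at least `2/3` every state at trace distance at least
`ε` from `P` (the infimum over the empty set being `+∞`). -/
def IsTester (P : Set (EuclideanSpace ℂ ι)) (ε : ℝ) (k : ℕ)
    (Λ : Matrix (Fin k → ι) (Fin k → ι) ℂ) : Prop :=
  IsMeasurement Λ ∧
    ∀ ψ : EuclideanSpace ℂ ι, ‖ψ‖ = 1 →
      (ψ ∈ P → 2 / 3 ≤ acceptProb Λ (tensorPow k ψ)) ∧
      ((ε : EReal) ≤ ⨅ φ ∈ P, (traceDist ψ φ : EReal) →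
        2 / 3 ≤ 1 - acceptProb Λ (tensorPow k ψ))

/-- The space `ℂ^{d 0} ⊗ ⋯ ⊗ ℂ^{d (n-1)}` of `n` qudits, in the computational basis. -/
abbrev Qudits {n : ℕ} (d : Fin n → ℕ) : Type := EuclideanSpace ℂ ((i : Fin n) → Fin (d i))

/-- `ψ = |α⟩_S ⊗ |β⟩_{Sᶜ}` for some states `α` of the subsystems in `S` and `β` of the others. -/
def IsProductAcross {n : ℕ} {d : Fin n → ℕ} (S : Finset (Fin n)) (ψ : Qudits d) : Prop :=
  ∃ (α : EuclideanSpace ℂ ((i : {i // i ∈ S}) → Fin (d i)))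
    (β : EuclideanSpace ℂ ((i : {i // i ∉ S}) → Fin (d i))),
    ‖α‖ = 1 ∧ ‖β‖ = 1 ∧
      ∀ x : (i : Fin n) → Fin (d i), ψ x = α (fun i => x i) * β (fun i => x i)

/-- The pure states of `n` qudits that are product across some cut `S : Sᶜ`, where `S` is a
nonempty proper subset of the parties. -/
def productAcrossSomeCut {n : ℕ} (d : Fin n → ℕ) : Set (Qudits d) :=
  {ψ | ‖ψ‖ = 1 ∧ ∃ S : Finset (Fin n), S.Nonempty ∧ S ≠ Finset.univ ∧ IsProductAcross S ψ}

end QTest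

end

/-!
For each cut, a swap test on one side of the cut, applied to two copies of `ψ`, accepts with
probability `(1 + p) / 2`, where `p` is the purity of the reduced state. Product states have `p = 1`
and always pass. Conversely `p` is at most the largest squared overlap of `ψ` with a product state,
so a state `ε`-far from all of these passes with probability at most `1 - ε² / 2`, and passes
`m ≈ 5 n / ε²` independent tests with probability too small to matter even after summing over the
`2ⁿ` cuts.

It remains to combine the tests of all cuts on the same copies. If `A` is the sum of their
projections, the operator `A (A + 1/2)⁻¹` lies below `1` and `2 A`, so it accepts far states with
small probability; and if one of the projections fixes `|φ⟩`, then `|φ⟩⟨φ| ≤ A`, which forces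
acceptance of `φ` with probability at least `1 / (1 + 1/2) = 2/3`.
-/

noncomputable section

namespace QTest

open Matrix InnerProductSpace
open scoped ComplexOrder MatrixOrder

section Algebra

lemma isStarProjection_half_smul_one_add {R : Type*} [Ring R] [StarRing R] [Algebra ℝ R]
    [StarModule ℝ R] {u : R} (hu : IsSelfAdjoint u) (hu_sq : u * u = 1) :
    IsStarProjection ((1 / 2 : ℝ) • (1 + u)) where
  isIdempotentElem := by
    rw [IsIdempotentElem, smul_mul_smul_comm, mul_add, add_mul, add_mul, hu_sq]
    simp only [one_mul, mul_one]
    module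
  isSelfAdjoint := (IsSelfAdjoint.all (1 / 2 : ℝ)).smul ((IsSelfAdjoint.one R).add hu)

variable {R : Type*} [NonUnitalRing R] [StarRing R] [TopologicalSpace R] [Module ℝ R]
  [SMulCommClass ℝ R R] [IsScalarTower ℝ R R] [StarModule ℝ R] [IsTopologicalRing R] [T2Space R]
  [NonUnitalContinuousFunctionalCalculus ℝ R IsSelfAdjoint]
  [PartialOrder R] [StarOrderedRing R] [NonnegSpectrumClass ℝ R]

lemma abs_eq_inv_smul_mul_self {a : R} (ha : IsSelfAdjoint a) {s : ℝ} (hs : 0 ≤ s)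
    (h : a * a * a = s ^ 2 • a) : CFC.abs a = s⁻¹ • (a * a) := by
  have ha_sq : star a * a = a * a := by rw [ha.star_eq]
  have ha_nonneg : 0 ≤ a * a := ha_sq ▸ star_mul_self_nonneg a
  have hs_abs : s • CFC.abs a = a * a := by
    rw [← CFC.sqrt_mul_self (a * a)]
    refine (CFC.sqrt_unique ?_ (smul_nonneg hs (CFC.abs_nonneg a))).symm
    rw [smul_mul_smul_comm, CFC.abs_mul_abs, ha_sq, ← mul_assoc, h, smul_mul_assoc, sq]
  rcases hs.eq_or_lt with rfl | hs_pos
  · rw [CFC.abs, ha_sq, ← hs_abs]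
    simp
  · rw [← hs_abs, inv_smul_smul₀ hs_pos.ne']

end Algebra

section PureState

variable {ι : Type}

lemma proj_eq_vecMulVec (ψ : EuclideanSpace ℂ ι) : proj ψ = vecMulVec ψ.ofLp (star ψ.ofLp) := rfl

lemma isHermitian_proj (ψ : EuclideanSpace ℂ ι) : (proj ψ).IsHermitian := by
  rw [proj_eq_vecMulVec, IsHermitian, conjTranspose_vecMulVec, star_star]

lemma isMeasurement_iff [DecidableEq ι] {Λ : Matrix ι ι ℂ} : IsMeasurement Λ ↔ 0 ≤ Λ ∧ Λ ≤ 1 := by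
  rw [IsMeasurement, nonneg_iff_posSemidef, le_iff]

variable [Fintype ι]

lemma trace_proj_mul_proj (φ ψ : EuclideanSpace ℂ ι) :
    (proj φ * proj ψ).trace = (‖⟪φ, ψ⟫_ℂ‖ ^ 2 : ℝ) := by
  rw [proj_eq_vecMulVec, proj_eq_vecMulVec, vecMulVec_mul_vecMulVec, trace_vecMulVec,
    dotProduct_smul, dotProduct_comm (star φ.ofLp), ← EuclideanSpace.inner_eq_star_dotProduct,
    ← EuclideanSpace.inner_eq_star_dotProduct, ← inner_conj_symm ψ φ, smul_eq_mul,
    Complex.mul_conj', Complex.ofReal_pow]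

lemma trace_proj (ψ : EuclideanSpace ℂ ι) : (proj ψ).trace = (‖ψ‖ ^ 2 : ℝ) := by
  rw [proj_eq_vecMulVec, trace_vecMulVec, ← EuclideanSpace.inner_eq_star_dotProduct,
    inner_self_eq_norm_sq_to_K]
  norm_cast

lemma norm_inner_sq_le_one {ψ φ : EuclideanSpace ℂ ι} (hψ : ‖ψ‖ = 1) (hφ : ‖φ‖ = 1) :
    ‖⟪ψ, φ⟫_ℂ‖ ^ 2 ≤ 1 :=
  pow_le_one₀ (norm_nonneg _) (by
    simpa only [hψ, hφ, mul_one] using norm_inner_le_norm (𝕜 := ℂ) ψ φ)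

lemma proj_mul_mul_proj (T : Matrix ι ι ℂ) (ψ : EuclideanSpace ℂ ι) :
    proj ψ * T * proj ψ = (T * proj ψ).trace • proj ψ := by
  rw [proj_eq_vecMulVec, vecMulVec_mul, vecMulVec_mul_vecMulVec, mul_vecMulVec, trace_vecMulVec,
    vecMulVec_smul, ← dotProduct_mulVec, dotProduct_comm]

lemma isStarProjection_proj {ψ : EuclideanSpace ℂ ι} (hψ : ‖ψ‖ = 1) :
    IsStarProjection (proj ψ) where
  isIdempotentElem := by
    classical
    have h := proj_mul_mul_proj 1 ψ
    rwa [mul_one, one_mul, trace_proj, hψ, one_pow, Complex.ofReal_one, one_smul] at h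
  isSelfAdjoint := isHermitian_proj ψ

lemma trace_mul_proj_of_isHermitian {T : Matrix ι ι ℂ} (hT : T.IsHermitian)
    (ψ : EuclideanSpace ℂ ι) : (T * proj ψ).trace = acceptProb T ψ := by
  refine (Complex.conj_eq_iff_re.1 ?_).symm
  rw [starRingEnd_apply, ← trace_conjTranspose, conjTranspose_mul, hT.eq, (isHermitian_proj ψ).eq,
    trace_mul_comm]

lemma acceptProb_nonneg {T : Matrix ι ι ℂ} (hT : 0 ≤ T) (ψ : EuclideanSpace ℂ ι) :
    0 ≤ acceptProb T ψ := by
  rw [acceptProb, proj_eq_vecMulVec, mul_vecMulVec, trace_vecMulVec, dotProduct_comm]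
  exact (nonneg_iff_posSemidef.1 hT).re_dotProduct_nonneg ψ.ofLp

lemma acceptProb_add (T U : Matrix ι ι ℂ) (ψ : EuclideanSpace ℂ ι) :
    acceptProb (T + U) ψ = acceptProb T ψ + acceptProb U ψ := by
  simp only [acceptProb, add_mul, trace_add, Complex.add_re]

lemma acceptProb_sub (T U : Matrix ι ι ℂ) (ψ : EuclideanSpace ℂ ι) :
    acceptProb (T - U) ψ = acceptProb T ψ - acceptProb U ψ := by
  simp only [acceptProb, sub_mul, trace_sub, Complex.sub_re]

lemma acceptProb_smul (c : ℝ) (T : Matrix ι ι ℂ) (ψ : EuclideanSpace ℂ ι) :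
    acceptProb (c • T) ψ = c * acceptProb T ψ := by
  simp only [acceptProb, smul_mul_assoc, trace_smul, Complex.smul_re, smul_eq_mul]

lemma acceptProb_sum {σ : Type*} (s : Finset σ) (T : σ → Matrix ι ι ℂ) (ψ : EuclideanSpace ℂ ι) :
    acceptProb (∑ i ∈ s, T i) ψ = ∑ i ∈ s, acceptProb (T i) ψ := by
  simp only [acceptProb, Finset.sum_mul, trace_sum, Complex.re_sum]

lemma acceptProb_mono {T U : Matrix ι ι ℂ} (h : T ≤ U) (ψ : EuclideanSpace ℂ ι) :
    acceptProb T ψ ≤ acceptProb U ψ :=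
  sub_nonneg.1 <| acceptProb_sub U T ψ ▸ acceptProb_nonneg (sub_nonneg.2 h) ψ

/-- Write `P`, `R` for the two rank-one projections and `t = |⟨ψ, φ⟩|²`. Since `P R P = t P` and
`R P R = t R`, the difference satisfies `(P - R)³ = (1 - t) (P - R)`. -/
lemma proj_sub_proj_pow_three {ψ φ : EuclideanSpace ℂ ι} (hψ : ‖ψ‖ = 1) (hφ : ‖φ‖ = 1) :
    (proj ψ - proj φ) * (proj ψ - proj φ) * (proj ψ - proj φ) =
      (1 - ‖⟪ψ, φ⟫_ℂ‖ ^ 2) • (proj ψ - proj φ) := by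
  have hP : proj ψ * proj ψ = proj ψ := (isStarProjection_proj hψ).isIdempotentElem
  have hR : proj φ * proj φ = proj φ := (isStarProjection_proj hφ).isIdempotentElem
  have hPRP := proj_mul_mul_proj (proj φ) ψ
  have hRPR := proj_mul_mul_proj (proj ψ) φ
  rw [trace_mul_comm, trace_proj_mul_proj, Complex.coe_smul] at hPRP
  rw [trace_proj_mul_proj, Complex.coe_smul] at hRPR
  calc (proj ψ - proj φ) * (proj ψ - proj φ) * (proj ψ - proj φ)
      = proj ψ - proj φ - proj ψ * proj φ * proj ψ + proj φ * proj ψ * proj φ := by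
        simp only [mul_sub, sub_mul, hP, hR, mul_assoc _ (proj φ) (proj φ),
          mul_assoc _ (proj ψ) (proj ψ)]
        abel
    _ = _ := by rw [hPRP, hRPR]; module

lemma trace_proj_sub_proj_mul_self {ψ φ : EuclideanSpace ℂ ι} (hψ : ‖ψ‖ = 1) (hφ : ‖φ‖ = 1) :
    ((proj ψ - proj φ) * (proj ψ - proj φ)).trace = (2 * (1 - ‖⟪ψ, φ⟫_ℂ‖ ^ 2) : ℝ) := by
  simp only [mul_sub, sub_mul, trace_sub, trace_proj_mul_proj, inner_self_eq_norm_sq_to_K, hψ, hφ,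
    norm_inner_symm φ ψ]
  norm_num
  ring

variable [DecidableEq ι]

lemma acceptProb_one (ψ : EuclideanSpace ℂ ι) : acceptProb 1 ψ = ‖ψ‖ ^ 2 := by
  rw [acceptProb, one_mul, trace_proj, Complex.ofReal_re]

theorem traceDist_eq_sqrt {ψ φ : EuclideanSpace ℂ ι} (hψ : ‖ψ‖ = 1) (hφ : ‖φ‖ = 1) :
    traceDist ψ φ = √(1 - ‖⟪ψ, φ⟫_ℂ‖ ^ 2) := by
  set s := √(1 - ‖⟪ψ, φ⟫_ℂ‖ ^ 2)
  have hs_sq : s ^ 2 = 1 - ‖⟪ψ, φ⟫_ℂ‖ ^ 2 :=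
    Real.sq_sqrt (sub_nonneg.2 (norm_inner_sq_le_one hψ hφ))
  have h_abs : CFC.abs (proj ψ - proj φ) = s⁻¹ • ((proj ψ - proj φ) * (proj ψ - proj φ)) :=
    abs_eq_inv_smul_mul_self ((isHermitian_proj ψ).sub (isHermitian_proj φ)) (Real.sqrt_nonneg _)
      (hs_sq ▸ proj_sub_proj_pow_three hψ hφ)
  calc traceDist ψ φ = 1 / 2 * (s⁻¹ * (2 * s ^ 2)) := by
        rw [traceDist, trAbs, h_abs, trace_smul, trace_proj_sub_proj_mul_self hψ hφ, hs_sq,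
          Complex.smul_re, Complex.ofReal_re, smul_eq_mul]
    _ = s⁻¹ * s * s := by ring
    _ = s := inv_mul_mul_self s

end PureState

section TensorPower

variable {J R l m n : Type*} [Fintype J] [CommSemiring R]

/-- The tensor power `T ⊗ ⋯ ⊗ T` of a matrix, with one factor for each element of `J`. -/
def kroneckerPow (J : Type*) [Fintype J] (T : Matrix m n R) : Matrix (J → m) (J → n) R :=
  of fun x y => ∏ j, T (x j) (y j)

lemma kroneckerPow_mul [DecidableEq J] [Fintype m] (T : Matrix l m R) (U : Matrix m n R) :
    kroneckerPow J (T * U) = kroneckerPow J T * kroneckerPow J U := by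
  ext x y
  simp only [kroneckerPow, of_apply, mul_apply, Fintype.prod_sum, Finset.prod_mul_distrib]

lemma trace_kroneckerPow [DecidableEq J] [Fintype n] (T : Matrix n n R) :
    (kroneckerPow J T).trace = T.trace ^ Fintype.card J := by
  rw [trace, trace, ← Finset.card_univ, ← Finset.prod_const, Fintype.prod_sum]
  rfl

lemma conjTranspose_kroneckerPow [StarRing R] (T : Matrix m n R) :
    (kroneckerPow J T)ᴴ = kroneckerPow J Tᴴ := by
  ext x y
  simp only [kroneckerPow, conjTranspose_apply, of_apply, star_prod]

lemma isStarProjection_kroneckerPow [DecidableEq J] [Fintype n] [StarRing R] {T : Matrix n n R}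
    (hT : IsStarProjection T) : IsStarProjection (kroneckerPow J T) where
  isIdempotentElem := by rw [IsIdempotentElem, ← kroneckerPow_mul, hT.isIdempotentElem.eq]
  isSelfAdjoint := (conjTranspose_kroneckerPow T).trans
    (congrArg (kroneckerPow J) hT.isSelfAdjoint.star_eq)

variable {ι : Type}

lemma proj_tensorPow (k : ℕ) (ψ : EuclideanSpace ℂ ι) :
    proj (tensorPow k ψ) = kroneckerPow (Fin k) (proj ψ) := by
  ext x y
  simp only [proj, tensorPow, kroneckerPow, vecMulVec_apply, of_apply, star_prod,
    Finset.prod_mul_distrib]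

variable [Fintype ι]

lemma norm_tensorPow (k : ℕ) (ψ : EuclideanSpace ℂ ι) : ‖tensorPow k ψ‖ = ‖ψ‖ ^ k := by
  have h_trace := trace_proj (tensorPow k ψ)
  rw [proj_tensorPow, trace_kroneckerPow, trace_proj, Fintype.card_fin, ← Complex.ofReal_pow,
    Complex.ofReal_inj, ← pow_mul, mul_comm, pow_mul] at h_trace
  exact (pow_left_inj₀ (norm_nonneg _) (by positivity) two_ne_zero).1 h_trace.symm

end TensorPower

section QuantumOr

variable {ι : Type} [DecidableEq ι] {c : ℝ} {A : Matrix ι ι ℂ}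

lemma posDef_add_smul_one (hc : 0 < c) (hA : 0 ≤ A) : (A + c • 1).PosDef :=
  PosDef.posSemidef_add (nonneg_iff_posSemidef.1 hA) (PosDef.one.smul hc)

variable [Fintype ι]

lemma mul_acceptProb_inv_le_one {M : Matrix ι ι ℂ} (hM : M.PosDef) {a : ℝ}
    {ψ : EuclideanSpace ℂ ι} (h : a • proj ψ ≤ M) : a * acceptProb M⁻¹ ψ ≤ 1 := by
  set t := acceptProb M⁻¹ ψ with ht_def
  have hM_inv := hM.inv.posSemidef
  have h_conj : a • (M⁻¹ * proj ψ * M⁻¹) ≤ M⁻¹ := by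
    have h_le := star_left_conjugate_le_conjugate h M⁻¹
    rwa [star_eq_conjTranspose, hM_inv.isHermitian.eq, mul_smul_comm, smul_mul_assoc,
      nonsing_inv_mul M ((isUnit_iff_isUnit_det M).1 hM.isUnit), one_mul] at h_le
  have h_overlap : acceptProb (M⁻¹ * proj ψ * M⁻¹) ψ = t * t := by
    rw [acceptProb, mul_assoc, mul_assoc, ← mul_assoc (proj ψ), proj_mul_mul_proj,
      trace_mul_proj_of_isHermitian hM_inv.isHermitian, ← ht_def, mul_smul_comm, trace_smul,
      trace_mul_proj_of_isHermitian hM_inv.isHermitian, ← ht_def, smul_eq_mul,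
      ← Complex.ofReal_mul, Complex.ofReal_re]
  have ht_nonneg : 0 ≤ t := acceptProb_nonneg (nonneg_iff_posSemidef.2 hM_inv) ψ
  have ht_le : a * (t * t) ≤ t := by
    simpa only [acceptProb_smul, h_overlap] using acceptProb_mono h_conj ψ
  rcases ht_nonneg.eq_or_lt with ht_zero | ht_pos
  · simp only [← ht_zero, mul_zero, zero_le_one]
  · exact le_of_mul_le_mul_right (by linarith) ht_pos

/-- The operator `A (A + c)⁻¹`, a quantum analogue of the disjunction of the measurements `Q s`
when `A = ∑ s, Q s`. It is below both `1` and `c⁻¹ A`, yet close to `1` on the ranges of the `Q s`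
when these are projections and `c` is small. -/
def quantumOr (c : ℝ) (A : Matrix ι ι ℂ) : Matrix ι ι ℂ := A * (A + c • 1)⁻¹

lemma inv_add_smul_one_nonneg (hc : 0 < c) (hA : 0 ≤ A) : 0 ≤ (A + c • 1)⁻¹ :=
  nonneg_iff_posSemidef.2 (posDef_add_smul_one hc hA).inv.posSemidef

lemma quantumOr_eq_one_sub (hc : 0 < c) (hA : 0 ≤ A) :
    quantumOr c A = 1 - c • (A + c • 1)⁻¹ := by
  have h_det := (isUnit_iff_isUnit_det _).1 (posDef_add_smul_one hc hA).isUnit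
  rw [quantumOr, eq_sub_iff_add_eq, ← smul_one_mul c (A + c • 1)⁻¹, ← add_mul,
    mul_nonsing_inv _ h_det]

lemma commute_inv_add_smul_one (hc : 0 < c) (hA : 0 ≤ A) : Commute A (A + c • 1)⁻¹ := by
  have h_det := (isUnit_iff_isUnit_det _).1 (posDef_add_smul_one hc hA).isUnit
  have h_left : (A + c • 1)⁻¹ * A = 1 - c • (A + c • 1)⁻¹ := by
    rw [eq_sub_iff_add_eq, ← mul_smul_one c (A + c • 1)⁻¹, ← mul_add, nonsing_inv_mul _ h_det]
  exact (quantumOr_eq_one_sub hc hA).trans h_left.symm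

lemma isMeasurement_quantumOr (hc : 0 < c) (hA : 0 ≤ A) : IsMeasurement (quantumOr c A) := by
  have h_inv := inv_add_smul_one_nonneg hc hA
  refine isMeasurement_iff.2 ⟨(commute_inv_add_smul_one hc hA).mul_nonneg hA h_inv, ?_⟩
  rw [quantumOr_eq_one_sub hc hA]
  exact sub_le_self 1 (smul_nonneg hc.le h_inv)

lemma smul_quantumOr_le (hc : 0 < c) (hA : 0 ≤ A) : c • quantumOr c A ≤ A := by
  have h_comm := commute_inv_add_smul_one hc hA
  have h_sub : A - c • quantumOr c A = A * A * (A + c • 1)⁻¹ := by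
    rw [mul_assoc, ← quantumOr, quantumOr_eq_one_sub hc hA, mul_sub, mul_one, mul_smul_comm,
      ← quantumOr, quantumOr_eq_one_sub hc hA]
  rw [← sub_nonneg, h_sub]
  exact (h_comm.mul_left h_comm).mul_nonneg ((Commute.refl A).mul_nonneg hA hA)
    (inv_add_smul_one_nonneg hc hA)

lemma acceptProb_quantumOr_le (hc : 0 < c) (hA : 0 ≤ A) (ψ : EuclideanSpace ℂ ι) :
    acceptProb (quantumOr c A) ψ ≤ c⁻¹ * acceptProb A ψ := by
  rw [le_inv_mul_iff₀ hc, ← acceptProb_smul]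
  exact acceptProb_mono (smul_quantumOr_le hc hA) ψ

lemma one_div_one_add_le_acceptProb_quantumOr (hc : 0 < c) {ψ : EuclideanSpace ℂ ι}
    (hψ : ‖ψ‖ = 1) (hA : proj ψ ≤ A) : 1 / (1 + c) ≤ acceptProb (quantumOr c A) ψ := by
  have hP := isStarProjection_proj hψ
  have hA_nonneg : 0 ≤ A := hP.nonneg.trans hA
  have h_le : (1 + c) • proj ψ ≤ A + c • 1 := by
    rw [add_smul, one_smul]
    exact add_le_add hA (smul_le_smul_of_nonneg_left hP.le_one hc.le)
  have h_inv := mul_acceptProb_inv_le_one (posDef_add_smul_one hc hA_nonneg) h_le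
  rw [quantumOr_eq_one_sub hc hA_nonneg, acceptProb_sub, acceptProb_one, acceptProb_smul, hψ,
    div_le_iff₀ (by positivity)]
  nlinarith [mul_le_mul_of_nonneg_left h_inv hc.le]

theorem isTester_quantumOr {P : Set (EuclideanSpace ℂ ι)} {ε : ℝ} {k : ℕ} {σ : Type*}
    {I : Finset σ} {Q : σ → Matrix (Fin k → ι) (Fin k → ι) ℂ}
    (hQ : ∀ s ∈ I, IsStarProjection (Q s))
    (h_complete : ∀ ψ ∈ P, ‖ψ‖ = 1 →
      ∃ s ∈ I, Q s * proj (tensorPow k ψ) = proj (tensorPow k ψ))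
    (h_sound : ∀ ψ : EuclideanSpace ℂ ι, ‖ψ‖ = 1 →
      (ε : EReal) ≤ ⨅ φ ∈ P, (traceDist ψ φ : EReal) →
        ∑ s ∈ I, acceptProb (Q s) (tensorPow k ψ) ≤ 1 / 6) :
    IsTester P ε k (quantumOr (1 / 2) (∑ s ∈ I, Q s)) := by
  have hA : 0 ≤ ∑ s ∈ I, Q s := Finset.sum_nonneg fun s hs => (hQ s hs).nonneg
  refine ⟨isMeasurement_quantumOr one_half_pos hA, fun ψ hψ => ⟨fun hψP => ?_, fun h_far => ?_⟩⟩
  · obtain ⟨s, hs, h_fix⟩ := h_complete ψ hψP hψ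
    have h_norm_pow : ‖tensorPow k ψ‖ = 1 := by rw [norm_tensorPow, hψ, one_pow]
    have h_proj_le : proj (tensorPow k ψ) ≤ ∑ s ∈ I, Q s :=
      ((isStarProjection_proj h_norm_pow).le_of_mul_eq_right (hQ s hs) h_fix).trans
        (Finset.single_le_sum (fun s hs => (hQ s hs).nonneg) hs)
    have h_accept := one_div_one_add_le_acceptProb_quantumOr one_half_pos h_norm_pow h_proj_le
    norm_num at h_accept ⊢
    exact h_accept
  · have h_accept := acceptProb_quantumOr_le one_half_pos hA (tensorPow k ψ)
    rw [acceptProb_sum] at h_accept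
    linarith [h_sound ψ hψ h_far]

end QuantumOr

section Bipartite

variable {X A B : Type} (e : X ≃ A × B)

/-- The product vector `α ⊗ β` of the bipartite space obtained by reading `X` as `A × B`
through `e`. -/
def tensorVec (α : EuclideanSpace ℂ A) (β : EuclideanSpace ℂ B) : EuclideanSpace ℂ X :=
  WithLp.toLp 2 fun x => α (e x).1 * β (e x).2

/-- Row `a` of the coefficient matrix of the bipartite vector `ψ`, i.e. `(⟨a| ⊗ 1) ψ`. -/
def slice (ψ : EuclideanSpace ℂ X) (a : A) : EuclideanSpace ℂ B :=
  WithLp.toLp 2 fun b => ψ (e.symm (a, b))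

lemma tensorVec_smul_smul (a b : ℂ) (α : EuclideanSpace ℂ A) (β : EuclideanSpace ℂ B) :
    tensorVec e (a • α) (b • β) = (a * b) • tensorVec e α β := by
  ext x
  simp only [tensorVec, PiLp.smul_apply, smul_eq_mul]
  ring

variable [Fintype A] [Fintype B]

/-- The purity `tr ρ²` of the reduced state `ρ` of `ψ` on the subsystem `A`, whose entries are the
inner products of the slices of `ψ`. -/
def purity (ψ : EuclideanSpace ℂ X) : ℝ := ∑ a, ∑ a', ‖⟪slice e ψ a, slice e ψ a'⟫_ℂ‖ ^ 2

lemma purity_nonneg (ψ : EuclideanSpace ℂ X) : 0 ≤ purity e ψ := by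
  unfold purity
  positivity

variable [Fintype X]

lemma inner_tensorVec (α : EuclideanSpace ℂ A) (β : EuclideanSpace ℂ B)
    (ψ : EuclideanSpace ℂ X) :
    ⟪tensorVec e α β, ψ⟫_ℂ = ∑ a, star (α a) * ⟪β, slice e ψ a⟫_ℂ := by
  simp only [PiLp.inner_apply, RCLike.inner_apply, tensorVec, slice, Finset.mul_sum]
  rw [← e.symm.sum_comp, Fintype.sum_prod_type]
  simp only [e.apply_symm_apply, starRingEnd_apply, star_mul']
  exact Finset.sum_congr rfl fun a _ => Finset.sum_congr rfl fun b _ => by ring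

lemma norm_tensorVec (α : EuclideanSpace ℂ A) (β : EuclideanSpace ℂ B) :
    ‖tensorVec e α β‖ = ‖α‖ * ‖β‖ := by
  refine (pow_left_inj₀ (norm_nonneg _) (by positivity) two_ne_zero).1 ?_
  rw [mul_pow]
  simp only [EuclideanSpace.norm_sq_eq, tensorVec, norm_mul, mul_pow, Finset.sum_mul_sum]
  rw [← e.symm.sum_comp, Fintype.sum_prod_type]
  simp only [e.apply_symm_apply]

lemma sum_norm_slice_sq (ψ : EuclideanSpace ℂ X) : ∑ a, ‖slice e ψ a‖ ^ 2 = ‖ψ‖ ^ 2 := by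
  simp only [EuclideanSpace.norm_sq_eq, slice]
  rw [← e.symm.sum_comp, Fintype.sum_prod_type]

/-- Averaging over `a` with the weights `‖slice e ψ a‖²`, which sum to `1`: the right-hand sides sum
to the purity. -/
lemma exists_purity_mul_norm_slice_sq_le {ψ : EuclideanSpace ℂ X} (hψ : ‖ψ‖ = 1) :
    ∃ a, slice e ψ a ≠ 0 ∧ purity e ψ * ‖slice e ψ a‖ ^ 2 ≤
      ∑ a', ‖⟪slice e ψ a, slice e ψ a'⟫_ℂ‖ ^ 2 := by
  have h_weights : ∑ a, ‖slice e ψ a‖ ^ 2 = 1 := by rw [sum_norm_slice_sq, hψ, one_pow]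
  by_contra! h_lt
  have h_le : ∀ a, ∑ a', ‖⟪slice e ψ a, slice e ψ a'⟫_ℂ‖ ^ 2 ≤ purity e ψ * ‖slice e ψ a‖ ^ 2 := by
    intro a
    by_cases ha : slice e ψ a = 0
    · simp [ha]
    · exact (h_lt a ha).le
  obtain ⟨a, ha⟩ : ∃ a, slice e ψ a ≠ 0 := by
    by_contra! h_zero
    simp [h_zero] at h_weights
  have h_sum := Finset.sum_lt_sum (fun a _ => h_le a) ⟨a, Finset.mem_univ a, h_lt a ha⟩
  rw [← Finset.mul_sum, h_weights, mul_one] at h_sum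
  exact h_sum.false

/-- The factors are a slice `a`, as in the previous lemma, and the column `a` of the reduced state,
both normalized. -/
lemma exists_purity_le_norm_inner_tensorVec_sq {ψ : EuclideanSpace ℂ X} (hψ : ‖ψ‖ = 1) :
    ∃ α β, ‖α‖ = 1 ∧ ‖β‖ = 1 ∧ purity e ψ ≤ ‖⟪tensorVec e α β, ψ⟫_ℂ‖ ^ 2 := by
  obtain ⟨a, ha, h_le⟩ := exists_purity_mul_norm_slice_sq_le e hψ
  set r := slice e ψ a
  let c : EuclideanSpace ℂ A := WithLp.toLp 2 fun a' => ⟪r, slice e ψ a'⟫_ℂ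
  have hc_sq : ‖c‖ ^ 2 = ∑ a', ‖⟪r, slice e ψ a'⟫_ℂ‖ ^ 2 := EuclideanSpace.norm_sq_eq c
  have hc_apply : c a = ⟪r, r⟫_ℂ := rfl
  have hc : 0 < ‖c‖ := norm_pos_iff.2 fun h => ha <| inner_self_eq_zero.1 <| by
    rw [← hc_apply, h, PiLp.zero_apply]
  have h_inner : ⟪tensorVec e c r, ψ⟫_ℂ = (‖c‖ ^ 2 : ℝ) := by
    rw [inner_tensorVec, hc_sq, Complex.ofReal_sum]
    exact Finset.sum_congr rfl fun a' _ => by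
      rw [Complex.ofReal_pow, ← Complex.conj_mul', starRingEnd_apply]
  refine ⟨(‖c‖⁻¹ : ℂ) • c, (‖r‖⁻¹ : ℂ) • r, norm_smul_inv_norm (norm_pos_iff.1 hc),
    norm_smul_inv_norm ha, ?_⟩
  have h_overlap : ‖⟪tensorVec e ((‖c‖⁻¹ : ℂ) • c) ((‖r‖⁻¹ : ℂ) • r), ψ⟫_ℂ‖ = ‖c‖ / ‖r‖ := by
    rw [tensorVec_smul_smul, inner_smul_left, h_inner, norm_mul, RCLike.norm_conj, norm_mul,
      norm_inv, norm_inv, Complex.norm_of_nonneg (by positivity),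
      Complex.norm_of_nonneg (by positivity), Complex.norm_of_nonneg (by positivity)]
    field_simp
  rw [h_overlap, div_pow, le_div_iff₀ (by positivity), hc_sq]
  exact h_le

lemma exists_traceDist_tensorVec_sq_le [DecidableEq X] {ψ : EuclideanSpace ℂ X} (hψ : ‖ψ‖ = 1) :
    ∃ α β, ‖α‖ = 1 ∧ ‖β‖ = 1 ∧ traceDist ψ (tensorVec e α β) ^ 2 ≤ 1 - purity e ψ := by
  obtain ⟨α, β, hα, hβ, h_le⟩ := exists_purity_le_norm_inner_tensorVec_sq e hψ
  refine ⟨α, β, hα, hβ, ?_⟩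
  have h_norm : ‖tensorVec e α β‖ = 1 := by rw [norm_tensorVec, hα, hβ, one_mul]
  rw [traceDist_eq_sqrt hψ h_norm, Real.sq_sqrt (sub_nonneg.2 (norm_inner_sq_le_one hψ h_norm)),
    norm_inner_symm]
  exact sub_le_sub_left h_le 1

end Bipartite

section SwapTest

variable {X A B : Type}

/-- Two copies `ψ ⊗ ψ` of the state `ψ`, the input of a swap test. -/
def pairState (ψ : EuclideanSpace ℂ X) : EuclideanSpace ℂ (X × X) :=
  tensorVec (.refl (X × X)) ψ ψ

lemma pairState_apply (ψ : EuclideanSpace ℂ X) (p : X × X) : pairState ψ p = ψ p.1 * ψ p.2 := rfl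

lemma norm_pairState [Fintype X] (ψ : EuclideanSpace ℂ X) : ‖pairState ψ‖ = ‖ψ‖ ^ 2 :=
  (norm_tensorVec (.refl (X × X)) ψ ψ).trans (sq ‖ψ‖).symm

variable (e : X ≃ A × B)

/-- The permutation of the basis of two copies of the space that exchanges their
`A`-components. -/
def swapLeft : Equiv.Perm (X × X) :=
  Function.Involutive.toPerm
    (fun p => (e.symm ((e p.2).1, (e p.1).2), e.symm ((e p.1).1, (e p.2).2)))
    fun p => by simp only [e.apply_symm_apply, Prod.mk.eta, e.symm_apply_apply]

lemma swapLeft_apply (p : X × X) :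
    swapLeft e p = (e.symm ((e p.2).1, (e p.1).2), e.symm ((e p.1).1, (e p.2).2)) := rfl

lemma swapLeft_inv : (swapLeft e)⁻¹ = swapLeft e := Function.Involutive.toPerm_symm _

lemma pairState_tensorVec_comp_swapLeft (α : EuclideanSpace ℂ A) (β : EuclideanSpace ℂ B) :
    (pairState (tensorVec e α β)).ofLp ∘ swapLeft e = (pairState (tensorVec e α β)).ofLp := by
  ext p
  simp only [Function.comp_apply, pairState_apply, swapLeft_apply, tensorVec, e.apply_symm_apply]
  ring

variable [DecidableEq X]

/-- The accepting projection of the swap test on the `A`-parts of two copies. -/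
def swapTest : Matrix (X × X) (X × X) ℂ := (1 / 2 : ℝ) • (1 + (swapLeft e).permMatrix ℂ)

variable [Fintype X]

lemma isStarProjection_swapTest : IsStarProjection (swapTest e) := by
  refine isStarProjection_half_smul_one_add ?_ ?_
  · rw [IsSelfAdjoint, star_eq_conjTranspose, conjTranspose_permMatrix, swapLeft_inv]
  · nth_rewrite 1 [← swapLeft_inv]
    rw [← permMatrix_mul, mul_inv_cancel, permMatrix_one]

lemma swapLeft_permMatrix_mul_proj (φ : EuclideanSpace ℂ (X × X)) :
    (swapLeft e).permMatrix ℂ * proj φ = vecMulVec (φ.ofLp ∘ swapLeft e) (star φ.ofLp) := by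
  rw [proj_eq_vecMulVec, mul_vecMulVec, permMatrix_mulVec]

lemma swapTest_mul_proj_pairState_tensorVec (α : EuclideanSpace ℂ A) (β : EuclideanSpace ℂ B) :
    swapTest e * proj (pairState (tensorVec e α β)) = proj (pairState (tensorVec e α β)) := by
  rw [swapTest, smul_mul_assoc, add_mul, one_mul, swapLeft_permMatrix_mul_proj,
    pairState_tensorVec_comp_swapLeft, ← proj_eq_vecMulVec]
  module

variable [Fintype A] [Fintype B]

lemma trace_swapLeft_permMatrix_mul_proj (ψ : EuclideanSpace ℂ X) :
    ((swapLeft e).permMatrix ℂ * proj (pairState ψ)).trace =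
      ∑ a, ∑ a', ⟪slice e ψ a, slice e ψ a'⟫_ℂ * ⟪slice e ψ a', slice e ψ a⟫_ℂ := by
  rw [swapLeft_permMatrix_mul_proj, trace_vecMulVec, dotProduct,
    ← (e.symm.prodCongr e.symm).sum_comp]
  simp only [Fintype.sum_prod_type, PiLp.inner_apply, RCLike.inner_apply, Finset.sum_mul_sum]
  refine Finset.sum_congr rfl fun a _ => Finset.sum_comm.trans <|
    Finset.sum_congr rfl fun a' _ => Finset.sum_congr rfl fun b _ =>
      Finset.sum_congr rfl fun b' _ => ?_
  simp only [slice, swapLeft_apply, Function.comp_apply, Equiv.prodCongr_apply, Prod.map,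
    e.apply_symm_apply, Pi.star_apply, pairState_apply, star_mul', starRingEnd_apply]
  ring

lemma acceptProb_swapLeft_permMatrix (ψ : EuclideanSpace ℂ X) :
    acceptProb ((swapLeft e).permMatrix ℂ) (pairState ψ) = purity e ψ := by
  simp only [acceptProb, trace_swapLeft_permMatrix_mul_proj, Complex.re_sum, purity]
  refine Finset.sum_congr rfl fun a _ => Finset.sum_congr rfl fun a' _ => ?_
  rw [← inner_conj_symm (slice e ψ a'), Complex.mul_conj', ← Complex.ofReal_pow, Complex.ofReal_re]

lemma acceptProb_swapTest {ψ : EuclideanSpace ℂ X} (hψ : ‖ψ‖ = 1) :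
    acceptProb (swapTest e) (pairState ψ) = (1 + purity e ψ) / 2 := by
  rw [swapTest, acceptProb_smul, acceptProb_add, acceptProb_one, acceptProb_swapLeft_permMatrix,
    norm_pairState, hψ]
  ring

end SwapTest

section RepeatedSwapTest

/-- Grouping `m + m` copies into `m` pairs: copy `j` goes with copy `m + j`. -/
def pairsEquiv (X : Type) (m : ℕ) : (Fin (m + m) → X) ≃ (Fin m → X × X) :=
  (Fin.appendEquiv m m).symm.trans (Equiv.arrowProdEquivProdArrow (Fin m) _ _).symm

variable {X A B : Type} (m : ℕ)

lemma proj_tensorPow_add_self (ψ : EuclideanSpace ℂ X) :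
    proj (tensorPow (m + m) ψ) =
      (kroneckerPow (Fin m) (proj (pairState ψ))).submatrix (pairsEquiv X m) (pairsEquiv X m) := by
  ext x y
  simp only [proj_tensorPow, kroneckerPow, submatrix_apply, of_apply, Fin.prod_univ_add,
    ← Finset.prod_mul_distrib]
  refine Finset.prod_congr rfl fun j _ => ?_
  simp only [proj, vecMulVec_apply, pairState_apply, star_mul']
  exact mul_mul_mul_comm _ _ _ _

variable [Fintype X] [DecidableEq X] (e : X ≃ A × B)

/-- The projection accepting when `m` swap tests on disjoint pairs of copies all accept. -/
def repeatedSwapTest : Matrix (Fin (m + m) → X) (Fin (m + m) → X) ℂ :=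
  (kroneckerPow (Fin m) (swapTest e)).submatrix (pairsEquiv X m) (pairsEquiv X m)

lemma isStarProjection_repeatedSwapTest : IsStarProjection (repeatedSwapTest m e) := by
  have h := isStarProjection_kroneckerPow (J := Fin m) (isStarProjection_swapTest e)
  refine ⟨?_, h.isSelfAdjoint.isHermitian.submatrix _⟩
  rw [IsIdempotentElem, repeatedSwapTest, submatrix_mul_equiv, h.isIdempotentElem.eq]

lemma repeatedSwapTest_mul_proj_tensorPow (ψ : EuclideanSpace ℂ X) :
    repeatedSwapTest m e * proj (tensorPow (m + m) ψ) =
      (kroneckerPow (Fin m) (swapTest e * proj (pairState ψ))).submatrix (pairsEquiv X m)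
        (pairsEquiv X m) := by
  rw [repeatedSwapTest, proj_tensorPow_add_self, submatrix_mul_equiv, kroneckerPow_mul]

lemma repeatedSwapTest_mul_proj_tensorVec (α : EuclideanSpace ℂ A) (β : EuclideanSpace ℂ B) :
    repeatedSwapTest m e * proj (tensorPow (m + m) (tensorVec e α β)) =
      proj (tensorPow (m + m) (tensorVec e α β)) := by
  rw [repeatedSwapTest_mul_proj_tensorPow, swapTest_mul_proj_pairState_tensorVec,
    proj_tensorPow_add_self]

variable [Fintype A] [Fintype B]

lemma acceptProb_repeatedSwapTest {ψ : EuclideanSpace ℂ X} (hψ : ‖ψ‖ = 1) :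
    acceptProb (repeatedSwapTest m e) (tensorPow (m + m) ψ) = ((1 + purity e ψ) / 2) ^ m := by
  have h_trace : (swapTest e * proj (pairState ψ)).trace = ((1 + purity e ψ) / 2 : ℝ) := by
    rw [trace_mul_proj_of_isHermitian (isStarProjection_swapTest e).isSelfAdjoint.isHermitian,
      acceptProb_swapTest e hψ]
  have h_reindex (M : Matrix (Fin m → X × X) (Fin m → X × X) ℂ) :
      (M.submatrix (pairsEquiv X m) (pairsEquiv X m)).trace = M.trace :=
    (pairsEquiv X m).sum_comp fun y => M y y
  rw [acceptProb, repeatedSwapTest_mul_proj_tensorPow, h_reindex, trace_kroneckerPow, h_trace,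
    Fintype.card_fin, ← Complex.ofReal_pow, Complex.ofReal_re]

end RepeatedSwapTest

section Cuts

variable {n : ℕ}

/-- The sides `S` of the cuts `S : Sᶜ` of `n` parties. Each cut occurs twice, as `S` and as `Sᶜ`. -/
def cuts (n : ℕ) : Finset (Finset (Fin n)) := {S | S.Nonempty ∧ S ≠ Finset.univ}

lemma mem_cuts {S : Finset (Fin n)} : S ∈ cuts n ↔ S.Nonempty ∧ S ≠ Finset.univ := by
  rw [cuts, Finset.mem_filter_univ]

lemma two_le_of_mem_cuts {S : Finset (Fin n)} (hS : S ∈ cuts n) : 2 ≤ n := by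
  obtain ⟨h_nonempty, h_ne⟩ := mem_cuts.1 hS
  have h_pos := h_nonempty.card_pos
  have h_lt := Finset.card_lt_card (Finset.ssubset_univ_iff.2 h_ne)
  rw [Finset.card_fin] at h_lt
  omega

lemma card_cuts_le (n : ℕ) : (cuts n).card ≤ 2 ^ n := by
  rw [← Fintype.card_fin n, ← Fintype.card_finset, Fintype.card_fin]
  exact Finset.card_le_univ _

variable {d : Fin n → ℕ}

/-- Splitting the computational basis of `n` qudits along the cut `S : Sᶜ`. -/
def cutEquiv (d : Fin n → ℕ) (S : Finset (Fin n)) :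
    ((i : Fin n) → Fin (d i)) ≃
      ((i : {i // i ∈ S}) → Fin (d i)) × ((i : {i // i ∉ S}) → Fin (d i)) :=
  Equiv.piEquivPiSubtypeProd (· ∈ S) fun i => Fin (d i)

lemma mem_productAcrossSomeCut_iff {ψ : Qudits d} :
    ψ ∈ productAcrossSomeCut d ↔
      ∃ S ∈ cuts n, ∃ α β, ‖α‖ = 1 ∧ ‖β‖ = 1 ∧ ψ = tensorVec (cutEquiv d S) α β := by
  constructor
  · rintro ⟨-, S, h_nonempty, h_ne, α, β, hα, hβ, hψ⟩
    exact ⟨S, mem_cuts.2 ⟨h_nonempty, h_ne⟩, α, β, hα, hβ, PiLp.ext hψ⟩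
  · rintro ⟨S, hS, α, β, hα, hβ, rfl⟩
    obtain ⟨h_nonempty, h_ne⟩ := mem_cuts.1 hS
    exact ⟨by rw [norm_tensorVec, hα, hβ, one_mul], S, h_nonempty, h_ne, α, β, hα, hβ, fun _ => rfl⟩

lemma purity_le_of_far {ψ : Qudits d} (hψ : ‖ψ‖ = 1) {ε : ℝ} (hε : 0 ≤ ε)
    (h_far : (ε : EReal) ≤ ⨅ φ ∈ productAcrossSomeCut d, (traceDist ψ φ : EReal))
    {S : Finset (Fin n)} (hS : S ∈ cuts n) : purity (cutEquiv d S) ψ ≤ 1 - ε ^ 2 := by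
  obtain ⟨α, β, hα, hβ, h_sq⟩ := exists_traceDist_tensorVec_sq_le (cutEquiv d S) hψ
  have h_mem := mem_productAcrossSomeCut_iff.2 ⟨S, hS, α, β, hα, hβ, rfl⟩
  have h_dist : ε ≤ traceDist ψ (tensorVec (cutEquiv d S) α β) :=
    EReal.coe_le_coe_iff.1 (h_far.trans (iInf₂_le _ h_mem))
  linarith [pow_le_pow_left₀ hε h_dist 2]

end Cuts

section ErrorBound

lemma two_pow_mul_one_sub_pow_le {n m : ℕ} (hn : 2 ≤ n) {x : ℝ} (hx : x ≤ 1)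
    (h : 2 * n ≤ m * x) : 2 ^ n * (1 - x) ^ m ≤ 1 / 6 := by
  have h_exp_two : Real.exp (-2) ≤ 1 / 6 := by
    rw [Real.exp_neg, ← one_div, show (2 : ℝ) = 1 + 1 by norm_num, Real.exp_add]
    gcongr
    nlinarith [Real.exp_one_gt_d9]
  have h_pow : (1 - x) ^ m ≤ (1 / 6) ^ n :=
    calc (1 - x) ^ m ≤ Real.exp (-x) ^ m :=
          pow_le_pow_left₀ (sub_nonneg.2 hx) (Real.one_sub_le_exp_neg x) m
      _ = Real.exp (m * -x) := (Real.exp_nat_mul _ m).symm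
      _ ≤ Real.exp (n * -2) := Real.exp_le_exp.2 (by linarith)
      _ = Real.exp (-2) ^ n := Real.exp_nat_mul _ n
      _ ≤ (1 / 6) ^ n := by gcongr
  calc 2 ^ n * (1 - x) ^ m ≤ 2 ^ n * (1 / 6) ^ n := by gcongr
    _ = (1 / 3) ^ n := by rw [← mul_pow]; norm_num
    _ ≤ (1 / 3) ^ 2 := pow_le_pow_of_le_one (by norm_num) (by norm_num) hn
    _ ≤ 1 / 6 := by norm_num

/-- The number `⌊5 n / ε²⌋` of swap tests performed for each cut: it is at least `4 n / ε²`
whenever `n / ε² ≥ 1`. -/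
def swapTestCount (n : ℕ) (ε : ℝ) : ℕ := ⌊5 * (n / ε ^ 2)⌋₊

lemma swapTestCount_le (n : ℕ) (ε : ℝ) : (swapTestCount n ε : ℝ) ≤ 5 * (n / ε ^ 2) :=
  Nat.floor_le (by positivity)

lemma four_mul_le_swapTestCount {n : ℕ} {ε : ℝ} (h : 1 ≤ n / ε ^ 2) :
    4 * (n / ε ^ 2) ≤ swapTestCount n ε := by
  have h_floor := Nat.sub_one_lt_floor (5 * (n / ε ^ 2))
  rw [swapTestCount]
  linarith

variable {n : ℕ} {d : Fin n → ℕ} {ψ : Qudits d} {ε : ℝ}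

lemma acceptProb_repeatedSwapTest_le_of_far (hψ : ‖ψ‖ = 1) (hε : 0 ≤ ε)
    (h_far : (ε : EReal) ≤ ⨅ φ ∈ productAcrossSomeCut d, (traceDist ψ φ : EReal))
    {S : Finset (Fin n)} (hS : S ∈ cuts n) (m : ℕ) :
    acceptProb (repeatedSwapTest m (cutEquiv d S)) (tensorPow (m + m) ψ) ≤
      (1 - ε ^ 2 / 2) ^ m := by
  have h_nonneg := purity_nonneg (cutEquiv d S) ψ
  have h_le := purity_le_of_far hψ hε h_far hS
  rw [acceptProb_repeatedSwapTest m _ hψ]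
  exact pow_le_pow_left₀ (by linarith) (by linarith) m

/-- If there is a cut at all, then `n ≥ 2`, and the existence of a far state forces `ε ≤ 1`. -/
theorem sum_acceptProb_repeatedSwapTest_le_of_far (hψ : ‖ψ‖ = 1) (hε : 0 < ε)
    (h_far : (ε : EReal) ≤ ⨅ φ ∈ productAcrossSomeCut d, (traceDist ψ φ : EReal)) :
    ∑ S ∈ cuts n, acceptProb (repeatedSwapTest (swapTestCount n ε) (cutEquiv d S))
      (tensorPow (swapTestCount n ε + swapTestCount n ε) ψ) ≤ 1 / 6 := by
  rcases (cuts n).eq_empty_or_nonempty with h_empty | ⟨S, hS⟩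
  · rw [h_empty, Finset.sum_empty]
    norm_num
  set m := swapTestCount n ε
  have hn : (2 : ℝ) ≤ n := mod_cast two_le_of_mem_cuts hS
  have hε_sq : ε ^ 2 ≤ 1 :=
    sub_nonneg.1 ((purity_nonneg _ _).trans (purity_le_of_far hψ hε.le h_far hS))
  have hm : 4 * (n / ε ^ 2) ≤ m :=
    four_mul_le_swapTestCount ((one_le_div₀ (by positivity)).2 (by linarith))
  have hm_mul : 2 * n ≤ m * (ε ^ 2 / 2) := by
    have h := mul_le_mul_of_nonneg_right hm (sq_nonneg ε)
    rw [mul_assoc, div_mul_cancel₀ _ (by positivity)] at h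
    linarith
  calc _ ≤ (cuts n).card * (1 - ε ^ 2 / 2) ^ m := by
        rw [← nsmul_eq_mul]
        exact Finset.sum_le_card_nsmul _ _ _ fun S hS =>
          acceptProb_repeatedSwapTest_le_of_far hψ hε.le h_far hS m
    _ ≤ 2 ^ n * (1 - ε ^ 2 / 2) ^ m :=
        mul_le_mul_of_nonneg_right (mod_cast card_cuts_le n) (pow_nonneg (by linarith) m)
    _ ≤ 1 / 6 := two_pow_mul_one_sub_pow_le (two_le_of_mem_cuts hS) (by linarith) hm_mul

end ErrorBound

end QTest

end

theorem mainTheorem5 :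
    ∃ C : ℝ, 0 < C ∧ ∀ (n : ℕ) (ε : ℝ), 0 < ε →
      ∃ k : ℕ, (k : ℝ) ≤ C * (n / ε ^ 2) ∧
        ∀ d : Fin n → ℕ,
          ∃ Λ : Matrix (Fin k → ((i : Fin n) → Fin (d i))) (Fin k → ((i : Fin n) → Fin (d i))) ℂ,
            QTest.IsTester (QTest.productAcrossSomeCut d) ε k Λ := by
  refine ⟨10, by norm_num, fun n ε hε => ?_⟩
  set m := QTest.swapTestCount n ε
  refine ⟨m + m, ?_, fun d => ⟨QTest.quantumOr (1 / 2) (∑ S ∈ QTest.cuts n,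
    QTest.repeatedSwapTest m (QTest.cutEquiv d S)), QTest.isTester_quantumOr ?_ ?_ ?_⟩⟩
  · push_cast
    linarith [QTest.swapTestCount_le n ε]
  · exact fun S _ => QTest.isStarProjection_repeatedSwapTest m (QTest.cutEquiv d S)
  · intro ψ hψP _
    obtain ⟨S, hS, α, β, -, -, rfl⟩ := QTest.mem_productAcrossSomeCut_iff.1 hψP
    exact ⟨S, hS, QTest.repeatedSwapTest_mul_proj_tensorVec m (QTest.cutEquiv d S) α β⟩
  · exact fun ψ hψ h_far => QTest.sum_acceptProb_repeatedSwapTest_le_of_far hψ hε h_far
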